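/- **Setting.** Let $K$ be a number of receivers and let $\mathcal X$, $\mathcal Y_1,\dots,\mathcal Y_K$, $\mathcal U$, $\mathcal V_1,\dots,\mathcal V_K$ be finite alphabets and $\hat{\mathcal X}_1,\dots,\hat{\mathcal X}_K$ arbitrary reconstruction alphabets. Let $(X,Y_1,\dots,Y_K)$ be random variables on $\mathcal X\times\mathcal Y_1\times\cdots\times\mathcal Y_K$ (source and side information), let $p_{V_1\cdots V_K|U}$ be a memoryless broadcast channel with input alphabet $\mathcal U$ and output alphabets $\mathcal V_k$, and let $d_k:\mathcal X\times\hat{\mathcal X}_k\to[0,\infty)$ be distortion measures, extended to words by $d_k(x^n,\hat x^n)=\frac1n\sum_{j=1}^n d_k(x_j,\hat x_j)$. An $(m,n)$ code consists of an encoder $\phi:\mathcal X^n\to\mathcal U^m$ and decoders $\psi_k:\mathcal V_k^m\times\mathcal Y_k^n\to\hat{\mathcal X}_k^n$, $k=1,\dots,K$. Its expected distortion at receiver $k$ is $\mathrm E[d_k(X^n,\hat X_k^n)]$ with $\hat X_k^n=\psi_k(V_k^m,Y_k^n)$, where $(X^n,Y_1^n,\dots,Y_K^n)$ consists of $n$ i.i.d.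 copies of $(X,Y_1,\dots,Y_K)$ and $V_k^m$ is the output at receiver $k$ of $m$ uses of the channel with input word $\phi(X^n)$. A tuple $(D_1,\dots,D_K)$ of real numbers is *achievable* at a rational rate $\kappa$ (channel uses per source symbol) if for every $\epsilon>0$ there is $n_0$ such that for all integers $m>0$, $n>n_0$ with $\frac mn=\kappa$ there is an $(m,n)$ code with $\mathrm E[d_k(X^n,\hat X_k^n)]\le D_k+\epsilon$ for every $k=1,\dots,K$. **Statement.** Suppose that there exist a random variable $Z$ with values in a finite alphabet $\mathcal Z$, jointly distributed with $(X,Y_1,\dots,Y_K)$ and such that $(Y_1,\dots,Y_K)-X-Z$ is a Markov chain, a random variable $U$ on $\mathcal U$ (a channel input, with corresponding outputs $V_1,\dots,V_K$), and functions $g_k:\mathcal Z\times\mathcal Y_k\to\hat{\mathcal X}_k$ such that, for every $k=1,\dots,K$, $$I(X;Z\mid Y_k)<\kappa\, I(U;V_k)\qquad\text{and}\qquad \mathrm E\big[d_k(X,g_k(Z,Y_k))\big]\le D_k .$$ Then $(D_1,\dots,D_K)$ is achievable at rate $\kappa$. -/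

import Mathlib

open scoped NNReal

noncomputable section

namespace WZBC

/-! ### Finite-alphabet information measures -/

section Information

variable {Ω α β γ : Type*}

/-- `prob P A a` is the probability `P[A = a]` of a random variable `A` on the discrete
probability space `(Ω, P)`. -/
def prob (P : PMF Ω) (A : Ω → α) (a : α) : ℝ := (P.map A a).toReal

/-- The expectation `E[f]` on the finite probability space `(Ω, P)`. -/
def expect [Fintype Ω] (P : PMF Ω) (f : Ω → ℝ) : ℝ := ∑ ω, (P ω).toReal * f ω

/-- The mutual information `I(A;B) = ∑ p(a,b) log (p(a,b) / (p(a) p(b)))` (in nats). Terms with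
`p(a,b) = 0` are zero. -/
def mutualInfo [Fintype α] [Fintype β] (P : PMF Ω) (A : Ω → α) (B : Ω → β) : ℝ :=
  ∑ a, ∑ b, prob P (fun ω => (A ω, B ω)) (a, b) *
    Real.log (prob P (fun ω => (A ω, B ω)) (a, b) / (prob P A a * prob P B b))

/-- The conditional mutual information
`I(A;B|C) = ∑ p(a,b,c) log (p(a,b,c) p(c) / (p(a,c) p(b,c)))` (in nats). Terms with
`p(a,b,c) = 0` are zero. -/
def condMutualInfo [Fintype α] [Fintype β] [Fintype γ]
    (P : PMF Ω) (A : Ω → α) (B : Ω → β) (C : Ω → γ) : ℝ :=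
  ∑ a, ∑ b, ∑ c, prob P (fun ω => (A ω, B ω, C ω)) (a, b, c) *
    Real.log (prob P (fun ω => (A ω, B ω, C ω)) (a, b, c) * prob P C c /
      (prob P (fun ω => (A ω, C ω)) (a, c) * prob P (fun ω => (B ω, C ω)) (b, c)))

/-- The Markov chain `A - B - C`: `p(a,b,c) p(b) = p(a,b) p(b,c)`, that is, `A` and `C` are
conditionally independent given `B`. -/
def IsMarkovChain (P : PMF Ω) (A : Ω → α) (B : Ω → β) (C : Ω → γ) : Prop :=
  ∀ a b c, prob P (fun ω => (A ω, B ω, C ω)) (a, b, c) * prob P B b =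
    prob P (fun ω => (A ω, B ω)) (a, b) * prob P (fun ω => (B ω, C ω)) (b, c)

end Information

/-! ### Wyner-Ziv coding over a broadcast channel -/

section Coding

variable {K : ℕ} {X U : Type*} {Y V Xhat : Fin K → Type*}

/-- The joint law of the channel input and the tuple of channel outputs, when the input has law
`pU` and the channel is `W`. -/
def inputOutputLaw (pU : PMF U) (W : U → PMF (∀ k, V k)) : PMF (U × (∀ k, V k)) :=
  pU.bind fun u => (W u).map fun v => (u, v)

/-- A code with `m` channel uses for `n` source symbols: an encoder that sees the source word, and
one decoder for each receiver, which sees its own channel output word and side information word. -/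
structure Code (m n : ℕ) (X U : Type*) (Y V Xhat : Fin K → Type*) where
  /-- the encoder -/
  enc : (Fin n → X) → (Fin m → U)
  /-- the decoders -/
  dec : ∀ k, (Fin m → V k) × (Fin n → Y k) → (Fin n → Xhat k)

/-- The distortion between words, the average of the single-letter distortions. -/
def blockDistortion {A B : Type*} {n : ℕ} (d : A → B → ℝ≥0) (x : Fin n → A) (y : Fin n → B) : ℝ :=
  (1 / (n : ℝ)) * ∑ j, (d (x j) (y j) : ℝ)

/-- The expected distortion `E[d_k(X^n, ψ_k(V_k^m, Y_k^n))]` of a code at receiver `k`. The letters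
of the source and side information words `(X^n, Y_1^n, …, Y_K^n)` are independent with law `src`;
the channel `W` acts independently on each letter of the channel input word `φ(X^n)`. -/
def expectedDistortion [Fintype X] [∀ k, Fintype (Y k)] [∀ k, Fintype (V k)] {m n : ℕ}
    (src : PMF (X × (∀ k, Y k))) (W : U → PMF (∀ k, V k)) (d : ∀ k, X → Xhat k → ℝ≥0)
    (c : Code m n X U Y V Xhat) (k : Fin K) : ℝ :=
  ∑ s : Fin n → X × (∀ k, Y k), ∑ v : Fin m → (∀ k, V k),
    (∏ j, (src (s j)).toReal) * (∏ l, (W (c.enc (fun j => (s j).1) l) (v l)).toReal) *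
      blockDistortion (d k) (fun j => (s j).1)
        (c.dec k (fun l => v l k, fun j => (s j).2 k))

/-- The distortion tuple `D` is achievable at rate `κ` channel uses per source symbol. -/
def Achievable [Fintype X] [∀ k, Fintype (Y k)] [∀ k, Fintype (V k)]
    (src : PMF (X × (∀ k, Y k))) (W : U → PMF (∀ k, V k)) (d : ∀ k, X → Xhat k → ℝ≥0)
    (κ : ℚ) (D : Fin K → ℝ) : Prop :=
  ∀ ε : ℝ, 0 < ε → ∃ n₀ : ℕ, ∀ m n : ℕ, 0 < m → n₀ < n → (m : ℚ) / (n : ℚ) = κ →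
    ∃ c : Code m n X U Y V Xhat, ∀ k, expectedDistortion src W d c k ≤ D k + ε

end Coding

end WZBC

end

noncomputable section

namespace WZBC

open MeasureTheory ProbabilityTheory

/-! ### The exponential race -/

/-! The code is a joint source-channel code built on a matching argument instead of binning and
typicality. Put i.i.d. standard exponential clocks `T w` on the set of pairs of words `w = (z^n,
u^m)`, shared by the encoder and all decoders. Whoever holds weights `P` on this set selects the `w`
that minimises `T w / P w`. Two parties with weights `P` and `Q` both select `w` with probability at
least `P w * Q w / (P w + Q w)` (`exists_matching`).

The encoder uses `∏ p(z|x) ∏ p(u)` and sends the `u`-part of its selection. Decoder `k` uses `∏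
p(z|y_k) ∏ p(u|v_k)` and applies `g k` letter by letter to the `z`-part of its own. The encoder's
weights involve no receiver, so one encoder serves all of them. Some realisation of the clocks
bounds the sum of all failure probabilities, hence each one (`exists_one_shot_code`).

Averaged over the clocks, a mismatch has probability at most `E[x / (1 + x)]`, where `x = P w / Q w`
is a product of `n + m` independent factors. As `x / (1 + x) ≤ x ^ t` for `0 ≤ t ≤ 1`, this is a
Chernoff bound. Per source symbol, `log x` has mean `I(X;Z|Y_k) - κ I(U;V_k) < 0`, so a small `t`
gives exponential decay. A second Chernoff bound controls the event that the distortion of `z^n`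
exceeds `D k + ε`. On the remaining small event the distortion is bounded by a constant. -/

lemma expMeasure_one_Ioi {x : ℝ} (hx : 0 ≤ x) :
    expMeasure 1 (Set.Ioi x) = ENNReal.ofReal (Real.exp (-x)) := by
  have := isProbabilityMeasure_expMeasure one_pos
  have h := cdf_expMeasure_eq one_pos x
  rw [if_pos hx, one_mul, cdf_eq_real] at h
  have h2 : (expMeasure 1).real (Set.Ioi x) = Real.exp (-x) := by
    rw [← Set.compl_Iic, probReal_compl_eq_one_sub measurableSet_Iic, h]; ring
  rw [← h2, ofReal_measureReal]

/-- Among independent standard exponential variables, the probability that `T i` is positive and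
`c j * T i` is smaller than every other variable. -/
lemma pi_expMeasure_race {N : ℕ} (i : Fin (N + 1)) (c : Fin N → ℝ) (hc : ∀ j, 0 ≤ c j) :
    Measure.pi (fun _ : Fin (N + 1) => expMeasure 1)
      {T | 0 < T i ∧ ∀ j, c j * T i < T (i.succAbove j)} =
      ENNReal.ofReal (1 / (1 + ∑ j, c j)) := by
  have := isProbabilityMeasure_expMeasure one_pos
  have hC : 0 ≤ ∑ j, c j := Finset.sum_nonneg fun j _ => hc j
  set S' : Set (ℝ × (Fin N → ℝ)) := {p | 0 < p.1 ∧ ∀ j, c j * p.1 < p.2 j} with hS'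
  have hmeas : MeasurableSet S' := by
    rw [hS', Set.ofPred_and, Set.ofPred_forall]
    exact (measurableSet_lt measurable_const measurable_fst).inter
      (MeasurableSet.iInter fun j => measurableSet_lt (by fun_prop) (by fun_prop))
  -- Given `T i = t`, the other clocks independently survive past `c j * t`, with probability `exp
  -- (-c j * t)` each.
  have hF : ∀ t, Measure.pi (fun _ : Fin N => expMeasure 1) (Prod.mk t ⁻¹' S') =
      (Set.Ioi 0).indicator (fun t => ENNReal.ofReal (Real.exp (-((∑ j, c j) * t)))) t := by
    intro t
    by_cases ht : 0 < t
    · have : Prod.mk t ⁻¹' S' = Set.univ.pi fun j => Set.Ioi (c j * t) := by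
        ext T; simp [hS', ht]
      rw [this, Measure.pi_pi, Set.indicator_of_mem (Set.mem_Ioi.2 ht)]
      simp_rw [fun j => expMeasure_one_Ioi (mul_nonneg (hc j) ht.le)]
      rw [← ENNReal.ofReal_prod_of_nonneg (fun _ _ => (Real.exp_pos _).le), ← Real.exp_sum,
        Finset.sum_neg_distrib, Finset.sum_mul]
    · have : Prod.mk t ⁻¹' S' = ∅ := by
        ext T; simp [hS', ht]
      rw [this, measure_empty, Set.indicator_of_notMem (by simpa using ht)]
  have h := (measurePreserving_piFinSuccAbove (fun _ : Fin (N + 1) => expMeasure 1) i).measure_preimage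
    hmeas.nullMeasurableSet
  have hpre : MeasurableEquiv.piFinSuccAbove (fun _ : Fin (N + 1) => ℝ) i ⁻¹' S' =
      {T | 0 < T i ∧ ∀ j, c j * T i < T (i.succAbove j)} := by
    ext T; simp [hS', MeasurableEquiv.piFinSuccAbove, Fin.insertNthEquiv, Fin.removeNth]
  rw [hpre] at h
  rw [h, Measure.prod_apply hmeas]
  simp_rw [hF]
  rw [lintegral_indicator measurableSet_Ioi, expMeasure, gammaMeasure,
    setLIntegral_withDensity_eq_setLIntegral_mul _
      (show Measurable (gammaPDF 1 1) from (measurable_gammaPDFReal 1 1).ennreal_ofReal)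
      (by fun_prop) measurableSet_Ioi]
  rw [setLIntegral_congr_fun measurableSet_Ioi
    (g := fun t => ENNReal.ofReal (Real.exp (-(1 + ∑ j, c j) * t)))]
  · rw [← ofReal_integral_eq_lintegral_ofReal, integral_exp_mul_Ioi (by linarith)]
    · rw [mul_zero, Real.exp_zero, neg_div_neg_eq]
    · exact integrableOn_exp_mul_Ioi (by linarith) 0
    · exact Filter.Eventually.of_forall fun _ => (Real.exp_pos _).le
  · intro t ht
    have h1 : gammaPDF 1 1 t = ENNReal.ofReal (Real.exp (-t)) := by
      have := exponentialPDF_of_nonneg (r := 1) (le_of_lt ht)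
      rw [one_mul, one_mul] at this
      exact this
    change gammaPDF 1 1 t * _ = _
    rw [h1, ← ENNReal.ofReal_mul (Real.exp_pos _).le, ← Real.exp_add]
    congr 2; ring

/-- Common randomness on a finite set `W`, from which `w` is selected by the weights `P` on the
event `E P w`, so that two weights `P` and `Q` lead to the same selection `w` with probability at
least `P w * Q w / (P w + Q w)`. -/
lemma exists_matching (W : Type*) [Fintype W] [Nonempty W] :
    ∃ (Ω : Type) (_ : MeasurableSpace Ω) (μ : Measure Ω) (_ : IsProbabilityMeasure μ)
      (E : (W → ℝ) → W → Set Ω), (∀ P w, MeasurableSet (E P w)) ∧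
      (∀ P w w', w ≠ w' → ∀ T, T ∈ E P w → T ∉ E P w') ∧
      ∀ P Q : W → ℝ, (∀ w, 0 ≤ P w) → (∀ w, 0 ≤ Q w) → ∑ w, P w ≤ 1 → ∑ w, Q w ≤ 1 →
        ∀ w, P w * Q w / (P w + Q w) ≤ μ.real (E P w ∩ E Q w) := by
  classical
  obtain ⟨N, hN⟩ : ∃ N, Fintype.card W = N + 1 := Nat.exists_eq_succ_of_ne_zero Fintype.card_ne_zero
  let e : W ≃ Fin (N + 1) := Fintype.equivFinOfCardEq hN
  have := isProbabilityMeasure_expMeasure one_pos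
  -- The event says that `T w / P w` is the strict minimum. In cross-multiplied form it needs no
  -- convention for zero weights, and strictness makes the events disjoint for every `T`, not just
  -- almost surely.
  refine ⟨Fin (N + 1) → ℝ, inferInstance, Measure.pi fun _ => expMeasure 1, inferInstance,
    fun P w => {T | ∀ w', w' ≠ w → P w' * T (e w) < P w * T (e w')}, ?_, ?_, ?_⟩
  · intro P w
    simp_rw [Set.ofPred_forall]
    exact MeasurableSet.iInter fun w' => MeasurableSet.iInter fun _ =>
      measurableSet_lt (by fun_prop) (by fun_prop)
  · intro P w w' hne T h1 h2
    exact lt_asymm (h1 w' hne.symm) (h2 w hne)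
  · intro P Q hP hQ hP1 hQ1 w
    rcases (hP w).eq_or_lt with h0 | hPw
    · rw [← h0]; simp
    rcases (hQ w).eq_or_lt with h0 | hQw
    · rw [← h0]; simp
    -- Winning both races at `w` amounts to `T w' > c w' * T w` for all `w' ≠ w`, a single race with
    -- the larger of the two ratios.
    let c : W → ℝ := fun w' => max (P w' / P w) (Q w' / Q w)
    have hc : ∀ w', 0 ≤ c w' := fun w' => le_max_of_le_left (div_nonneg (hP _) hPw.le)
    let f : Fin N → W := fun j => e.symm ((e w).succAbove j)
    have hr := pi_expMeasure_race (e w) (fun j => c (f j)) (fun j => hc _)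
    -- Bound the maximum by the sum; the ratios `P w' / P w` over all `w'`, including `w`, add up to
    -- at most `1 / P w`.
    have hsum : 1 + ∑ j, c (f j) ≤ 1 / P w + 1 / Q w := by
      have key : ∀ R : W → ℝ, 0 < R w → ∑ w, R w ≤ 1 → 1 + ∑ j, R (f j) / R w ≤ 1 / R w := by
        intro R hR hR1
        have : ∑ w, R w = R w + ∑ j, R (f j) := by
          rw [← e.symm.sum_comp, Fin.sum_univ_succAbove _ (e w), e.symm_apply_apply]
        rw [← Finset.sum_div, le_div_iff₀ hR, add_mul, div_mul_cancel₀ _ hR.ne']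
        linarith
      have h1 := key P hPw hP1
      have h2 := key Q hQw hQ1
      have h3 : ∑ j, c (f j) ≤ ∑ j, P (f j) / P w + ∑ j, Q (f j) / Q w := by
        rw [← Finset.sum_add_distrib]
        exact Finset.sum_le_sum fun j _ => max_le_add_of_nonneg
          (div_nonneg (hP _) hPw.le) (div_nonneg (hQ _) hQw.le)
      linarith
    have hC : 0 ≤ ∑ j, c (f j) := Finset.sum_nonneg fun j _ => hc _
    calc P w * Q w / (P w + Q w) = 1 / (1 / P w + 1 / Q w) := by field_simp; ring
      _ ≤ 1 / (1 + ∑ j, c (f j)) := one_div_le_one_div_of_le (by linarith) hsum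
      _ = (Measure.pi fun _ : Fin (N + 1) => expMeasure 1).real
            {T | 0 < T (e w) ∧ ∀ j, c (f j) * T (e w) < T ((e w).succAbove j)} := by
          rw [measureReal_def, hr, ENNReal.toReal_ofReal (by positivity)]
      _ ≤ _ := by
          refine measureReal_mono ?_
          rintro T ⟨hT, h⟩
          have main : ∀ R : W → ℝ, 0 < R w → (∀ w', R w' / R w ≤ c w') →
              ∀ w', w' ≠ w → R w' * T (e w) < R w * T (e w') := by
            intro R hR hRc w' hw'
            obtain ⟨j, hj⟩ := Fin.exists_succAbove_eq (e.injective.ne hw')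
            have h1 := h j
            have hf : f j = w' := by simp [f, hj]
            rw [hf, hj] at h1
            have h2 := (mul_le_mul_of_nonneg_right (hRc w') hT.le).trans_lt h1
            rwa [div_mul_eq_mul_div, div_lt_iff₀ hR, mul_comm (T (e w'))] at h2
          exact ⟨main P hPw fun _ => le_max_left _ _, main Q hQw fun _ => le_max_right _ _⟩

/-! ### One-shot coding -/

open Classical in
/-- One-shot coding with one encoder and several decoders that select elements of `W`: the encoder
aims at the weights `P x`, and decoder `k` at the weights `Q k o`. -/
lemma exists_one_shot_code {ι S X V W U : Type*} {O : ι → Type*} [Fintype ι] [Fintype S] [Fintype V]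
    [Fintype W] [Nonempty W] (src : S → ℝ) (hsrc : ∀ s, 0 ≤ src s) (hsrc1 : ∑ s, src s = 1)
    (x : S → X) (u : W → U) (Ch : U → V → ℝ) (hCh : ∀ a v, 0 ≤ Ch a v)
    (hCh1 : ∀ a, ∑ v, Ch a v = 1) (P : X → W → ℝ) (hP : ∀ a w, 0 ≤ P a w)
    (hP1 : ∀ a, ∑ w, P a w ≤ 1) (Q : ∀ k, O k → W → ℝ) (hQ : ∀ k o w, 0 ≤ Q k o w)
    (hQ1 : ∀ k o, ∑ w, Q k o w ≤ 1) (obs : ∀ k, S → V → O k) (good : ι → S → W → Prop) :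
    ∃ (enc : X → W) (dec : ∀ k, O k → W), ∀ k,
      ∑ s, ∑ v, src s * Ch (u (enc (x s))) v *
        (if dec k (obs k s v) = enc (x s) ∧ good k s (enc (x s)) then 0 else 1) ≤
      ∑ k, (1 - ∑ s, ∑ w, ∑ v, src s * Ch (u w) v *
        (if good k s w then P (x s) w * Q k (obs k s v) w / (P (x s) w + Q k (obs k s v) w)
          else 0)) := by
  obtain ⟨Ω, _, μ, _, E, hmeas, hdisj, hE⟩ := exists_matching W
  let sel : (W → ℝ) → Ω → W := fun R T =>
    if h : ∃ w, T ∈ E R w then h.choose else Classical.arbitrary W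
  have hsel : ∀ R T w, T ∈ E R w → sel R T = w := by
    intro R T w hw
    have h : ∃ w, T ∈ E R w := ⟨w, hw⟩
    simp only [sel, dif_pos h]
    by_contra hne
    exact hdisj R _ _ hne T h.choose_spec hw
  -- `A` is the event that encoder and decoder `k` agree on `w`; `G k T` is a lower bound for the
  -- success probability at receiver `k` once the clocks are frozen at `T`.
  let A : ι → S → W → V → Set Ω := fun k s w v => E (P (x s)) w ∩ E (Q k (obs k s v)) w
  let G : ι → Ω → ℝ := fun k T => ∑ s, ∑ w, ∑ v, src s * Ch (u w) v *
    (if good k s w then (A k s w v).indicator 1 T else 0)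
  have hA : ∀ k s w v, MeasurableSet (A k s w v) := fun k s w v => (hmeas _ _).inter (hmeas _ _)
  have hint : ∀ k s w v, Integrable (fun T => src s * Ch (u w) v *
      (if good k s w then (A k s w v).indicator (1 : Ω → ℝ) T else 0)) μ := by
    intro k s w v
    refine Integrable.const_mul ?_ _
    split_ifs
    · exact (integrable_const (1 : ℝ)).indicator (hA k s w v)
    · exact integrable_zero _ _ _
  have hGint : ∀ k, Integrable (G k) μ := fun k =>
    integrable_finsetSum _ fun s _ => integrable_finsetSum _ fun w _ =>
      integrable_finsetSum _ fun v _ => hint k s w v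
  have hG : ∀ k, ∑ s, ∑ w, ∑ v, src s * Ch (u w) v *
      (if good k s w then P (x s) w * Q k (obs k s v) w / (P (x s) w + Q k (obs k s v) w)
        else 0) ≤ ∫ T, G k T ∂μ := by
    intro k
    rw [integral_finsetSum _ fun s _ => integrable_finsetSum _ fun w _ =>
      integrable_finsetSum _ fun v _ => hint k s w v]
    refine Finset.sum_le_sum fun s _ => ?_
    rw [integral_finsetSum _ fun w _ => integrable_finsetSum _ fun v _ => hint k s w v]
    refine Finset.sum_le_sum fun w _ => ?_
    rw [integral_finsetSum _ fun v _ => hint k s w v]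
    refine Finset.sum_le_sum fun v _ => ?_
    rw [integral_const_mul]
    refine mul_le_mul_of_nonneg_left ?_ (mul_nonneg (hsrc _) (hCh _ _))
    split_ifs
    · rw [integral_indicator_one (hA k s w v)]
      exact hE _ _ (hP _) (hQ _ _) (hP1 _) (hQ1 _ _) w
    · simp
  -- Derandomisation: one `T` must suit all receivers, so the sum over `k` is averaged.
  obtain ⟨T, hT⟩ := exists_integral_le (integrable_finsetSum Finset.univ fun k _ => hGint k)
  rw [integral_finsetSum _ fun k _ => hGint k] at hT
  refine ⟨fun a => sel (P a) T, fun k o => sel (Q k o) T, fun k => ?_⟩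
  let bad : ι → ℝ := fun k => ∑ s, ∑ v, src s * Ch (u (sel (P (x s)) T)) v *
    (if sel (Q k (obs k s v)) T = sel (P (x s)) T ∧ good k s (sel (P (x s)) T) then 0 else 1)
  have hbad0 : ∀ k, 0 ≤ bad k := fun k => Finset.sum_nonneg fun s _ => Finset.sum_nonneg fun v _ =>
    mul_nonneg (mul_nonneg (hsrc _) (hCh _ _)) (by split_ifs <;> norm_num)
  have hbadG : ∀ k, bad k ≤ 1 - G k T := by
    intro k
    have h1 : (1 : ℝ) = ∑ s, ∑ v, src s * Ch (u (sel (P (x s)) T)) v := by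
      simp_rw [← Finset.mul_sum, hCh1, mul_one, hsrc1]
    rw [h1, ← Finset.sum_sub_distrib]
    refine Finset.sum_le_sum fun s _ => ?_
    -- By disjointness, only the encoder's own selection contributes to `G k T`.
    rw [Finset.sum_eq_single (sel (P (x s)) T), ← Finset.sum_sub_distrib]
    · refine Finset.sum_le_sum fun v _ => ?_
      have h0 := mul_nonneg (hsrc s) (hCh (u (sel (P (x s)) T)) v)
      rw [← mul_one_sub]
      refine mul_le_mul_of_nonneg_left ?_ h0
      by_cases hg : good k s (sel (P (x s)) T)
      · by_cases hm : T ∈ A k s (sel (P (x s)) T) v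
        · rw [if_pos ⟨hsel _ _ _ hm.2, hg⟩, if_pos hg, Set.indicator_of_mem hm]
          simp
        · rw [if_pos hg, Set.indicator_of_notMem hm]
          split_ifs <;> norm_num
      · simp [hg]
    · intro w _ hw
      refine Finset.sum_eq_zero fun v _ => ?_
      have hm : T ∉ A k s w v := fun hm => hw (hsel _ _ _ hm.1).symm
      rw [Set.indicator_of_notMem hm]
      simp
    · simp
  calc bad k ≤ ∑ k, bad k := Finset.single_le_sum (fun k _ => hbad0 k) (Finset.mem_univ k)
    _ ≤ ∑ k, (1 - G k T) := Finset.sum_le_sum fun k _ => hbadG k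
    _ ≤ _ := by
      rw [Finset.sum_sub_distrib, Finset.sum_sub_distrib]
      exact sub_le_sub_left ((Finset.sum_le_sum fun k _ => hG k).trans hT) _

/-! ### Exponential bounds for product laws -/

lemma sum_pi_prod_eq_pow {A : Type*} [Fintype A] (n : ℕ) (F : A → ℝ) :
    ∑ a : Fin n → A, ∏ j, F (a j) = (∑ a, F a) ^ n := by
  rw [← Fintype.prod_sum, Finset.prod_const, Finset.card_univ, Fintype.card_fin]

lemma sum_words_eq_pow_mul_pow {S Z U V : Type*} [Fintype S] [Fintype Z] [Fintype U] [Fintype V]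
    (n m : ℕ) (F : S → Z → ℝ) (G : U → V → ℝ) :
    ∑ s : Fin n → S, ∑ w : (Fin n → Z) × (Fin m → U), ∑ v : Fin m → V,
      (∏ j, F (s j) (w.1 j)) * ∏ l, G (w.2 l) (v l) =
    (∑ s, ∑ z, F s z) ^ n * (∑ u, ∑ v, G u v) ^ m := by
  rw [← sum_pi_prod_eq_pow, ← sum_pi_prod_eq_pow, Finset.sum_mul_sum]
  simp_rw [Fintype.prod_sum, Fintype.sum_prod_type, Finset.sum_mul_sum]
  refine Finset.sum_congr rfl fun s _ => ?_
  rw [Finset.sum_comm]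

lemma hasDerivAt_log_mgf {A : Type*} [Fintype A] (p f : A → ℝ) (hp1 : ∑ a, p a = 1) :
    HasDerivAt (fun t => Real.log (∑ a, p a * Real.exp (t * f a))) (∑ a, p a * f a) 0 := by
  have h : HasDerivAt (fun t => ∑ a, p a * Real.exp (t * f a)) (∑ a, p a * f a) 0 := by
    refine HasDerivAt.fun_sum fun a _ => ?_
    have := (((hasDerivAt_id (0 : ℝ)).mul_const (f a)).exp).const_mul (p a)
    simpa using this
  have := h.log (by simp [hp1])
  simpa [hp1] using this

/-- Provides the Chernoff parameter; `t ≤ 1` is recorded because `div_one_add_le_rpow` needs it. -/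
lemma exists_neg_of_hasDerivAt_neg {φ : ℝ → ℝ} {D : ℝ} (h : HasDerivAt φ D 0) (h0 : φ 0 = 0)
    (hD : D < 0) : ∃ t, 0 < t ∧ t ≤ 1 ∧ φ t < 0 := by
  have h1 := (hasDerivAt_iff_tendsto_slope.1 h).eventually (gt_mem_nhds hD)
  have h2 := h1.filter_mono (nhdsWithin_mono 0 (s := Set.Ioi 0) fun y hy => (ne_of_gt hy))
  have h3 : ∀ᶠ t in nhdsWithin (0 : ℝ) (Set.Ioi 0), t ∈ Set.Ioo (0 : ℝ) 1 :=
    Ioo_mem_nhdsGT one_pos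
  obtain ⟨t, ht, ht1⟩ := (h2.and h3).exists
  refine ⟨t, ht1.1, ht1.2.le, ?_⟩
  rw [slope_def_field, h0, sub_zero, sub_zero] at ht
  by_contra hn
  exact absurd ht (not_lt.2 (div_nonneg (not_lt.1 hn) ht1.1.le))

lemma mgf_pos {A : Type*} [Fintype A] (p f : A → ℝ) (hp : ∀ a, 0 ≤ p a) (hp1 : ∑ a, p a = 1)
    (t : ℝ) : 0 < ∑ a, p a * Real.exp (t * f a) := by
  have h0 : ∀ a ∈ Finset.univ, 0 ≤ p a * Real.exp (t * f a) :=
    fun a _ => mul_nonneg (hp a) (Real.exp_pos _).le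
  refine (Finset.sum_nonneg h0).lt_of_ne fun h => ?_
  have h1 := (Finset.sum_eq_zero_iff_of_nonneg h0).1 h.symm
  have : ∑ a, p a = 0 := Finset.sum_eq_zero fun a ha =>
    (mul_eq_zero.1 (h1 a ha)).resolve_right (Real.exp_pos _).ne'
  linarith

/-- If `E f + κ E h < 0`, then some exponential moment of a sum of `n` copies of `f` and `κ n`
copies of `h` decays exponentially. -/
lemma exists_exp_moment_decay {A B : Type*} [Fintype A] [Fintype B] (p f : A → ℝ) (p' h : B → ℝ)
    (hp : ∀ a, 0 ≤ p a) (hp1 : ∑ a, p a = 1) (hp' : ∀ b, 0 ≤ p' b) (hp1' : ∑ b, p' b = 1) (κ : ℝ)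
    (hneg : ∑ a, p a * f a + κ * ∑ b, p' b * h b < 0) :
    ∃ t ρ : ℝ, 0 < t ∧ t ≤ 1 ∧ 0 ≤ ρ ∧ ρ < 1 ∧ ∀ n m : ℕ, (m : ℝ) = κ * n →
      (∑ a, p a * Real.exp (t * f a)) ^ n * (∑ b, p' b * Real.exp (t * h b)) ^ m ≤ ρ ^ n := by
  -- The log-moment generating function per source symbol vanishes at `0` and has slope equal to the
  -- negative mean there; `ρ` is the exponential of its value at `t`.
  obtain ⟨t, ht0, ht1, ht⟩ := exists_neg_of_hasDerivAt_neg
    ((hasDerivAt_log_mgf p f hp1).add ((hasDerivAt_log_mgf p' h hp1').const_mul κ))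
    (by simp [hp1, hp1']) hneg
  refine ⟨t, _, ht0, ht1, (Real.exp_pos _).le, Real.exp_lt_one_iff.2 ht, fun n m hm => le_of_eq ?_⟩
  have h1 := mgf_pos p f hp hp1 t
  have h2 := mgf_pos p' h hp' hp1' t
  conv_lhs => rw [← Real.exp_log h1, ← Real.exp_log h2]
  rw [← Real.exp_nat_mul, ← Real.exp_nat_mul, ← Real.exp_nat_mul, ← Real.exp_add, hm]
  simp only [Pi.add_apply]
  congr 1; ring

/-- The left side is at most `min 1 x`, which lies below `x ^ t` for exponents in `[0, 1]`. -/
lemma div_one_add_le_rpow {x t : ℝ} (hx : 0 < x) (ht0 : 0 ≤ t) (ht1 : t ≤ 1) :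
    x / (1 + x) ≤ x ^ t := by
  rcases le_total 1 x with h | h
  · exact ((div_le_one (by linarith)).2 (by linarith)).trans (Real.one_le_rpow h ht0)
  · calc x / (1 + x) ≤ x := div_le_self hx.le (by linarith)
      _ = x ^ (1 : ℝ) := (Real.rpow_one x).symm
      _ ≤ x ^ t := Real.rpow_le_rpow_of_exponent_ge hx h ht1

open Classical in
/-- The matching bound for words: source letters `s` with `z` drawn from `r s`, channel inputs `u`
drawn from `pU`, and a decoder with weights `r'` and `t'`. -/
lemma one_sub_matching_le {S Z U V : Type*} [Fintype S] [Fintype Z] [Fintype U] [Fintype V]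
    (src : S → ℝ) (r r' : S → Z → ℝ) (pU : U → ℝ) (Ch : U → V → ℝ) (t' : V → U → ℝ)
    (δ : S → Z → ℝ) (hsrc : ∀ s, 0 ≤ src s) (hr : ∀ s z, 0 ≤ r s z)
    (hpU : ∀ u, 0 ≤ pU u) (hCh : ∀ u v, 0 ≤ Ch u v) (hq1 : ∑ s, ∑ z, src s * r s z = 1)
    (hb1 : ∑ u, ∑ v, pU u * Ch u v = 1)
    (hr' : ∀ s z, 0 < src s * r s z → 0 < r' s z) (ht' : ∀ u v, 0 < pU u * Ch u v → 0 < t' v u)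
    (a t : ℝ) (ha : 0 ≤ a) (ht0 : 0 ≤ t) (ht1 : t ≤ 1) (n m : ℕ) :
    1 - ∑ s : Fin n → S, ∑ w : (Fin n → Z) × (Fin m → U), ∑ v : Fin m → V,
        (∏ j, src (s j)) * (∏ l, Ch (w.2 l) (v l)) *
        (if ∑ j, δ (s j) (w.1 j) ≤ 0 then
          ((∏ j, r (s j) (w.1 j)) * ∏ l, pU (w.2 l)) *
            ((∏ j, r' (s j) (w.1 j)) * ∏ l, t' (v l) (w.2 l)) /
          (((∏ j, r (s j) (w.1 j)) * ∏ l, pU (w.2 l)) +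
            ((∏ j, r' (s j) (w.1 j)) * ∏ l, t' (v l) (w.2 l))) else 0) ≤
      (∑ s, ∑ z, src s * r s z * Real.exp (a * δ s z)) ^ n +
      (∑ s, ∑ z, src s * r s z * Real.exp (t * Real.log (r s z / r' s z))) ^ n *
        (∑ u, ∑ v, pU u * Ch u v * Real.exp (t * Real.log (pU u / t' v u))) ^ m := by
  have e0 := sum_words_eq_pow_mul_pow n m (fun s z => src s * r s z) (fun u v => pU u * Ch u v)
  have e1 := sum_words_eq_pow_mul_pow n m (fun s z => src s * r s z * Real.exp (a * δ s z))
    (fun u v => pU u * Ch u v)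
  have e2 := sum_words_eq_pow_mul_pow n m
    (fun s z => src s * r s z * Real.exp (t * Real.log (r s z / r' s z)))
    (fun u v => pU u * Ch u v * Real.exp (t * Real.log (pU u / t' v u)))
  rw [hq1, hb1, one_pow, one_pow, mul_one] at e0
  rw [hb1, one_pow, mul_one] at e1
  rw [← e1, ← e2, ← e0]
  simp_rw [← Finset.sum_sub_distrib, ← Finset.sum_add_distrib]
  refine Finset.sum_le_sum fun s _ => Finset.sum_le_sum fun w _ => Finset.sum_le_sum fun v _ => ?_
  obtain ⟨z, u⟩ := w
  simp only [Finset.prod_mul_distrib]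
  have hA : 0 ≤ ∏ j, src (s j) := Finset.prod_nonneg fun j _ => hsrc _
  have hB : 0 ≤ ∏ l, Ch (u l) (v l) := Finset.prod_nonneg fun j _ => hCh _ _
  have hR : 0 ≤ ∏ j, r (s j) (z j) := Finset.prod_nonneg fun j _ => hr _ _
  have hT : 0 ≤ ∏ l, pU (u l) := Finset.prod_nonneg fun j _ => hpU _
  -- If some letter has probability zero, both sides of the termwise inequality vanish; otherwise
  -- all logarithms are of positive ratios.
  by_cases hsr : (∀ j, 0 < src (s j) * r (s j) (z j)) ∧ ∀ l, 0 < pU (u l) * Ch (u l) (v l)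
  · obtain ⟨h1, h2⟩ := hsr
    have hrj : ∀ j, 0 < r (s j) (z j) := fun j => pos_of_mul_pos_right (h1 j) (hsrc _)
    have hpl : ∀ l, 0 < pU (u l) := fun l => pos_of_mul_pos_left (h2 l) (hCh _ _)
    have hr'j := fun j => hr' _ _ (h1 j)
    have ht'l := fun l => ht' _ _ (h2 l)
    have hexp1 : ∏ j, Real.exp (a * δ (s j) (z j)) = Real.exp (a * ∑ j, δ (s j) (z j)) := by
      rw [← Real.exp_sum, Finset.mul_sum]
    have hexp : ∀ {n : ℕ} (f g : Fin n → ℝ), (∀ j, 0 < f j) → (∀ j, 0 < g j) →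
        ∏ j, Real.exp (t * Real.log (f j / g j)) = ((∏ j, f j) / ∏ j, g j) ^ t := by
      intro n f g hf hg
      rw [← Finset.prod_div_distrib, ← Real.finsetProd_rpow _ _
        fun j _ => (div_pos (hf j) (hg j)).le]
      refine Finset.prod_congr rfl fun j _ => ?_
      rw [Real.rpow_def_of_pos (div_pos (hf j) (hg j)), mul_comm]
    rw [hexp1, hexp (fun j => r (s j) (z j)) (fun j => r' (s j) (z j)) hrj hr'j,
      hexp (fun l => pU (u l)) (fun l => t' (v l) (u l)) hpl ht'l]
    have hR := Finset.prod_pos fun j (_ : j ∈ Finset.univ) => hrj j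
    have hT := Finset.prod_pos fun j (_ : j ∈ Finset.univ) => hpl j
    have hR' := Finset.prod_pos fun j (_ : j ∈ Finset.univ) => hr'j j
    have hT' := Finset.prod_pos fun j (_ : j ∈ Finset.univ) => ht'l j
    set A := ∏ j, src (s j)
    set B := ∏ l, Ch (u l) (v l)
    set R := ∏ j, r (s j) (z j)
    set T := ∏ l, pU (u l)
    set R' := ∏ j, r' (s j) (z j)
    set T' := ∏ l, t' (v l) (u l)
    have key : ∀ e1 e2 x : ℝ, R * T - x ≤ R * T * (e1 + e2) →
        A * R * (T * B) - A * B * x ≤ A * R * e1 * (T * B) + A * B * (R * T * e2) := by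
      intro e1 e2 x h
      have := mul_le_mul_of_nonneg_left h (mul_nonneg hA hB)
      linarith
    have hpow : (R / R') ^ t * (T / T') ^ t = (R * T / (R' * T')) ^ t := by
      rw [← Real.mul_rpow (div_pos hR hR').le (div_pos hT hT').le, div_mul_div_comm]
    have hRT := mul_pos hR hT
    have hRT' := mul_pos hR' hT'
    have hx := div_pos hRT hRT'
    refine (key (Real.exp (a * ∑ j, δ (s j) (z j))) ((R * T / (R' * T')) ^ t) _ ?_).trans
      (le_of_eq (by rw [← hpow]; ring))
    have hpn : 0 ≤ (R * T / (R' * T')) ^ t := Real.rpow_nonneg hx.le _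
    -- On the good event the mismatch term pays; off it, Markov's exponential bound `1 ≤ exp (a * ∑
    -- δ)` pays.
    split_ifs with hg
    · calc R * T - R * T * (R' * T') / (R * T + R' * T')
          = R * T * ((R * T / (R' * T')) / (1 + R * T / (R' * T'))) := by field_simp; ring
        _ ≤ R * T * (R * T / (R' * T')) ^ t :=
            mul_le_mul_of_nonneg_left (div_one_add_le_rpow hx ht0 ht1) hRT.le
        _ ≤ _ := mul_le_mul_of_nonneg_left (le_add_of_nonneg_left (Real.exp_pos _).le) hRT.le
    · have : 1 ≤ Real.exp (a * ∑ j, δ (s j) (z j)) :=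
        Real.one_le_exp (mul_nonneg ha (not_le.1 hg).le)
      rw [sub_zero]
      exact le_mul_of_one_le_right hRT.le (by linarith)
  · have hzero : (∏ j, src (s j)) * (∏ l, Ch (u l) (v l)) = 0 ∨
        (∏ j, r (s j) (z j)) * (∏ l, pU (u l)) = 0 := by
      by_contra hne
      push Not at hne
      refine hsr ⟨fun j => ?_, fun l => ?_⟩
      · exact mul_pos
          ((hsrc _).lt_of_ne' (Finset.prod_ne_zero_iff.1 (left_ne_zero_of_mul hne.1) j
            (Finset.mem_univ _)))
          ((hr _ _).lt_of_ne' (Finset.prod_ne_zero_iff.1 (left_ne_zero_of_mul hne.2) j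
            (Finset.mem_univ _)))
      · exact mul_pos
          ((hpU _).lt_of_ne' (Finset.prod_ne_zero_iff.1 (right_ne_zero_of_mul hne.2) l
            (Finset.mem_univ _)))
          ((hCh _ _).lt_of_ne' (Finset.prod_ne_zero_iff.1 (right_ne_zero_of_mul hne.1) l
            (Finset.mem_univ _)))
    have h1 : ∀ A B R T x e1 e2 e3 : ℝ, A * B = 0 ∨ R * T = 0 ∧ x = 0 →
        A * R * (T * B) - A * B * x ≤ A * R * e1 * (T * B) + A * R * e2 * (T * B * e3) := by
      rintro A B R T x e1 e2 e3 (h | ⟨h, rfl⟩)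
      · exact le_of_eq (by linear_combination (R * T - x - R * T * e1 - R * T * e2 * e3) * h)
      · exact le_of_eq (by linear_combination (A * B - A * B * e1 - A * B * e2 * e3) * h)
    exact h1 _ _ _ _ _ _ _ _ (hzero.imp_right fun h => ⟨h, by simp [h]⟩)

open Classical in
/-- The matching bound for words tends to zero if the expected log-likelihood ratio and the
expectation of `δ` are negative. -/
lemma exists_tendsto_one_sub_matching_le {S Z U V : Type*} [Fintype S] [Fintype Z] [Fintype U]
    [Fintype V] (src : S → ℝ) (r r' : S → Z → ℝ) (pU : U → ℝ) (Ch : U → V → ℝ) (t' : V → U → ℝ)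
    (δ : S → Z → ℝ) (hsrc : ∀ s, 0 ≤ src s) (hr : ∀ s z, 0 ≤ r s z)
    (hpU : ∀ u, 0 ≤ pU u) (hCh : ∀ u v, 0 ≤ Ch u v) (hq1 : ∑ s, ∑ z, src s * r s z = 1)
    (hb1 : ∑ u, ∑ v, pU u * Ch u v = 1)
    (hr' : ∀ s z, 0 < src s * r s z → 0 < r' s z) (ht' : ∀ u v, 0 < pU u * Ch u v → 0 < t' v u)
    (κ : ℝ) (hδ : ∑ s, ∑ z, src s * r s z * δ s z < 0)
    (hneg : ∑ s, ∑ z, src s * r s z * Real.log (r s z / r' s z) +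
      κ * ∑ u, ∑ v, pU u * Ch u v * Real.log (pU u / t' v u) < 0) :
    ∃ β : ℕ → ℝ, Filter.Tendsto β Filter.atTop (nhds 0) ∧ ∀ n m : ℕ, (m : ℝ) = κ * n →
      1 - ∑ s : Fin n → S, ∑ w : (Fin n → Z) × (Fin m → U), ∑ v : Fin m → V,
        (∏ j, src (s j)) * (∏ l, Ch (w.2 l) (v l)) *
        (if ∑ j, δ (s j) (w.1 j) ≤ 0 then
          ((∏ j, r (s j) (w.1 j)) * ∏ l, pU (w.2 l)) *
            ((∏ j, r' (s j) (w.1 j)) * ∏ l, t' (v l) (w.2 l)) /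
          (((∏ j, r (s j) (w.1 j)) * ∏ l, pU (w.2 l)) +
            ((∏ j, r' (s j) (w.1 j)) * ∏ l, t' (v l) (w.2 l))) else 0) ≤ β n := by
  have hq0 : ∀ a : S × Z, 0 ≤ src a.1 * r a.1 a.2 := fun a => mul_nonneg (hsrc _) (hr _ _)
  have hb0 : ∀ b : U × V, 0 ≤ pU b.1 * Ch b.1 b.2 := fun b => mul_nonneg (hpU _) (hCh _ _)
  simp only [← Fintype.sum_prod_type'] at hq1 hb1 hδ hneg
  -- The distortion event involves no channel letters, so the second family is trivial and `κ = 0`,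
  -- `m = 0`.
  obtain ⟨a, ρ, ha, -, hρ0, hρ1, h1⟩ := exists_exp_moment_decay _
    (fun a : S × Z => δ a.1 a.2) (fun _ : Unit => (1 : ℝ)) 0 hq0 hq1 (by simp) (by simp) 0
    (by simpa using hδ)
  obtain ⟨t, σ, ht0, ht1, hσ0, hσ1, h2⟩ := exists_exp_moment_decay _
    (fun a : S × Z => Real.log (r a.1 a.2 / r' a.1 a.2)) _
    (fun b : U × V => Real.log (pU b.1 / t' b.2 b.1)) hq0 hq1 hb0 hb1 κ hneg
  simp only [Fintype.sum_prod_type] at hq1 hb1 h1 h2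
  refine ⟨fun n => ρ ^ n + σ ^ n, ?_, fun n m hm => ?_⟩
  · simpa using (tendsto_pow_atTop_nhds_zero_of_lt_one hρ0 hρ1).add
      (tendsto_pow_atTop_nhds_zero_of_lt_one hσ0 hσ1)
  · refine (one_sub_matching_le src r r' pU Ch t' δ hsrc hr hpU hCh hq1 hb1 hr' ht' a t ha.le ht0.le
      ht1 n m).trans (add_le_add ?_ (h2 n m hm))
    simpa using h1 n 0 (by simp)

lemma sum_words_le_one {Z U : Type*} [Fintype Z] [Fintype U] {n m : ℕ} (F : Fin n → Z → ℝ)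
    (G : Fin m → U → ℝ) (hF : ∀ j z, 0 ≤ F j z) (hG : ∀ l u, 0 ≤ G l u)
    (hF1 : ∀ j, ∑ z, F j z ≤ 1) (hG1 : ∀ l, ∑ u, G l u ≤ 1) :
    ∑ w : (Fin n → Z) × (Fin m → U), (∏ j, F j (w.1 j)) * ∏ l, G l (w.2 l) ≤ 1 := by
  simp only [Fintype.sum_prod_type]
  rw [← Finset.sum_mul_sum, ← Fintype.prod_sum, ← Fintype.prod_sum]
  exact mul_le_one₀ (Finset.prod_le_one (fun j _ => Finset.sum_nonneg fun z _ => hF j z)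
    fun j _ => hF1 j) (Finset.prod_nonneg fun j _ => Finset.sum_nonneg fun z _ => hG j z)
    (Finset.prod_le_one (fun j _ => Finset.sum_nonneg fun z _ => hG j z) fun j _ => hG1 j)

/-! ### Marginal probabilities -/

section Prob

variable {Ω α β : Type*}

lemma prob_nonneg (P : PMF Ω) (A : Ω → α) (a : α) : 0 ≤ prob P A a := ENNReal.toReal_nonneg

lemma sum_toReal_eq_one [Fintype Ω] (P : PMF Ω) : ∑ ω, (P ω).toReal = 1 := by
  rw [← ENNReal.toReal_sum fun ω _ => P.apply_ne_top ω, ← tsum_fintype (L := .unconditional _),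
    P.tsum_coe, ENNReal.toReal_one]

open Classical in
lemma prob_eq_sum [Fintype Ω] (P : PMF Ω) (A : Ω → α) (a : α) :
    prob P A a = ∑ ω, if A ω = a then (P ω).toReal else 0 := by
  rw [prob, PMF.map_apply, tsum_fintype, ENNReal.toReal_sum]
  · refine Finset.sum_congr rfl fun ω _ => ?_
    simp only [eq_comm (a := a)]
    split_ifs <;> simp
  · intro ω _
    split_ifs
    · exact P.apply_ne_top ω
    · simp

lemma sum_prob_mul [Fintype Ω] [Fintype α] (P : PMF Ω) (A : Ω → α) (f : α → ℝ) :
    ∑ a, prob P A a * f a = ∑ ω, (P ω).toReal * f (A ω) := by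
  classical
  simp_rw [prob_eq_sum, Finset.sum_mul]
  rw [Finset.sum_comm]
  refine Finset.sum_congr rfl fun ω _ => ?_
  simp [ite_mul]

lemma sum_prob_pair [Fintype Ω] [Fintype α] (P : PMF Ω) (A : Ω → α) (B : Ω → β) (b : β) :
    ∑ a, prob P (fun ω => (A ω, B ω)) (a, b) = prob P B b := by
  classical
  simp_rw [prob_eq_sum]
  rw [Finset.sum_comm]
  refine Finset.sum_congr rfl fun ω _ => ?_
  simp only [Prod.mk.injEq]
  by_cases h : B ω = b <;> simp [h]

lemma toReal_le_prob [Fintype Ω] (P : PMF Ω) (A : Ω → α) (ω : Ω) :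
    (P ω).toReal ≤ prob P A (A ω) := by
  classical
  rw [prob_eq_sum]
  have := Finset.single_le_sum (f := fun ω' => if A ω' = A ω then (P ω').toReal else 0)
    (fun ω' _ => by split_ifs <;> simp) (Finset.mem_univ ω)
  simpa using this

lemma prob_of_injective (P : PMF Ω) {A : Ω → α} (hA : Function.Injective A) (ω : Ω) :
    prob P A (A ω) = (P ω).toReal := by
  classical
  rw [prob, PMF.map_apply, tsum_eq_single ω]
  · simp
  · intro ω' h
    rw [if_neg fun h' => h (hA h').symm]

lemma prob_map (P : PMF Ω) (f : Ω → α) (A : α → β) :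
    prob (P.map f) A = prob P (fun ω => A (f ω)) := by
  funext b
  rw [prob, PMF.map_comp]
  rfl

lemma condWeight_nonneg (P : PMF Ω) (A : Ω → α) (B : Ω → β) (a : α) (b : β) :
    0 ≤ prob P (fun ω => (A ω, B ω)) (a, b) / prob P B b :=
  div_nonneg (prob_nonneg _ _ _) (prob_nonneg _ _ _)

/-- Only `≤ 1`: when `B = b` has probability zero, division by zero makes all the weights zero. -/
lemma sum_condWeight_le_one [Fintype Ω] [Fintype α] (P : PMF Ω) (A : Ω → α) (B : Ω → β) (b : β) :
    ∑ a, prob P (fun ω => (A ω, B ω)) (a, b) / prob P B b ≤ 1 := by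
  rw [← Finset.sum_div, sum_prob_pair]
  exact div_self_le_one _

lemma condWeight_pos [Fintype Ω] (P : PMF Ω) (A : Ω → α) (B : Ω → β) (ω : Ω)
    (h : 0 < (P ω).toReal) : 0 < prob P (fun ω => (A ω, B ω)) (A ω, B ω) / prob P B (B ω) :=
  div_pos (h.trans_le (toReal_le_prob P (fun ω => (A ω, B ω)) ω)) (h.trans_le (toReal_le_prob P B ω))

lemma condMutualInfo_eq_sum {γ : Type*} [Fintype Ω] [Fintype α] [Fintype β] [Fintype γ] (P : PMF Ω)
    (A : Ω → α) (B : Ω → β) (C : Ω → γ) :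
    condMutualInfo P A B C = ∑ ω, (P ω).toReal *
      Real.log (prob P (fun ω => (A ω, B ω, C ω)) (A ω, B ω, C ω) * prob P C (C ω) /
        (prob P (fun ω => (A ω, C ω)) (A ω, C ω) * prob P (fun ω => (B ω, C ω)) (B ω, C ω))) := by
  rw [← sum_prob_mul P (fun ω => (A ω, B ω, C ω)) fun x =>
    Real.log (prob P (fun ω => (A ω, B ω, C ω)) x * prob P C x.2.2 /
        (prob P (fun ω => (A ω, C ω)) (x.1, x.2.2) * prob P (fun ω => (B ω, C ω)) x.2))]
  simp only [condMutualInfo, Fintype.sum_prod_type]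

lemma mutualInfo_eq_sum [Fintype Ω] [Fintype α] [Fintype β] (P : PMF Ω)
    (A : Ω → α) (B : Ω → β) :
    mutualInfo P A B = ∑ ω, (P ω).toReal *
      Real.log (prob P (fun ω => (A ω, B ω)) (A ω, B ω) / (prob P A (A ω) * prob P B (B ω))) := by
  rw [← sum_prob_mul P (fun ω => (A ω, B ω)) fun x =>
    Real.log (prob P (fun ω => (A ω, B ω)) x / (prob P A x.1 * prob P B x.2))]
  simp only [mutualInfo, Fintype.sum_prod_type]

end Prob

/-! ### The test channel and the input law -/

section Letters

variable {X T Z : Type*}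

/-- The conditional law of `Z` given `X`. -/
def testChannel (Q : PMF ((X × T) × Z)) (x : X) (z : Z) : ℝ :=
  prob Q (fun ω => (ω.2, ω.1.1)) (z, x) / prob Q (fun ω => ω.1.1) x

lemma prob_swap {Ω α β : Type*} (P : PMF Ω) (A : Ω → α) (B : Ω → β) (a : α) (b : β) :
    prob P (fun ω => (A ω, B ω)) (a, b) = prob P (fun ω => (B ω, A ω)) (b, a) := by
  have h := prob_of_injective (P.map fun ω => (A ω, B ω)) Prod.swap_injective (a, b)
  rw [prob_map] at h
  exact h.symm

variable [Fintype X] [Fintype T] [Fintype Z]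

/-- By the Markov chain, drawing `Z` from `X` alone reproduces the joint law with all the side
information. -/
lemma src_mul_testChannel (Q : PMF ((X × T) × Z))
    (hM : IsMarkovChain Q (fun ω => ω.1.2) (fun ω => ω.1.1) (fun ω => ω.2)) (s : X × T) (z : Z) :
    (Q.map Prod.fst s).toReal * testChannel Q s.1 z = (Q (s, z)).toReal := by
  obtain ⟨x, y⟩ := s
  have h := hM y x z
  have h1 : prob Q (fun ω => (ω.1.2, ω.1.1, ω.2)) (y, x, z) = (Q ((x, y), z)).toReal :=
    prob_of_injective Q (A := fun ω : (X × T) × Z => (ω.1.2, ω.1.1, ω.2))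
      (fun a b h => by simp only [Prod.mk.injEq] at h; ext <;> simp [h]) ((x, y), z)
  have h2 : prob Q (fun ω => (ω.1.2, ω.1.1)) (y, x) = (Q.map Prod.fst (x, y)).toReal :=
    prob_swap Q (fun ω => ω.1.2) (fun ω => ω.1.1) y x
  rw [h1, h2, prob_swap Q (fun ω => ω.1.1) (fun ω => ω.2)] at h
  rw [testChannel, mul_div_assoc', ← h]
  by_cases h0 : prob Q (fun ω => ω.1.1) x = 0
  · have := toReal_le_prob Q (fun ω => ω.1.1) ((x, y), z)
    rw [h0] at this
    rw [h0, div_zero]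
    exact le_antisymm ENNReal.toReal_nonneg this
  · rw [mul_div_cancel_right₀ _ h0]

lemma prob_triple_eq (Q : PMF ((X × T) × Z)) {Y : Type*} (f : T → Y)
    (hM : IsMarkovChain Q (fun ω => ω.1.2) (fun ω => ω.1.1) (fun ω => ω.2)) (x : X) (z : Z) (y : Y) :
    prob Q (fun ω => (ω.1.1, ω.2, f ω.1.2)) (x, z, y) =
      prob Q (fun ω => (ω.1.1, f ω.1.2)) (x, y) * testChannel Q x z := by
  classical
  rw [← prob_map Q Prod.fst fun s => (s.1, f s.2), prob_eq_sum, prob_eq_sum, Fintype.sum_prod_type,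
    Finset.sum_mul]
  refine Finset.sum_congr rfl fun s _ => ?_
  rw [Finset.sum_eq_single z]
  · rw [← src_mul_testChannel Q hM]
    by_cases h : s.1 = x <;> by_cases h' : f s.2 = y <;> simp [h, h']
  · intro z' _ hz'
    simp [hz']
  · simp

/-- Since `p(z|x,y) = p(z|x)`, the information density is the log-ratio of encoder weight to decoder
weight for a source letter. -/
lemma condMutualInfo_eq_sum_testChannel (Q : PMF ((X × T) × Z)) {Y : Type*} [Fintype Y] (f : T → Y)
    (hM : IsMarkovChain Q (fun ω => ω.1.2) (fun ω => ω.1.1) (fun ω => ω.2)) :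
    condMutualInfo Q (fun ω => ω.1.1) (fun ω => ω.2) (fun ω => f ω.1.2) =
      ∑ s, ∑ z, (Q.map Prod.fst s).toReal * testChannel Q s.1 z *
        Real.log (testChannel Q s.1 z /
          (prob Q (fun ω => (ω.2, f ω.1.2)) (z, f s.2) / prob Q (fun ω => f ω.1.2) (f s.2))) := by
  rw [condMutualInfo_eq_sum, Fintype.sum_prod_type]
  refine Finset.sum_congr rfl fun s _ => Finset.sum_congr rfl fun z _ => ?_
  rw [src_mul_testChannel Q hM]
  by_cases h : (Q (s, z)).toReal = 0
  · rw [h, zero_mul, zero_mul]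
  have h1 : 0 < (Q (s, z)).toReal := ENNReal.toReal_nonneg.lt_of_ne' h
  have h2 := (h1.trans_le (toReal_le_prob Q (fun ω => (ω.1.1, f ω.1.2)) (s, z))).ne'
  simp only at h2 ⊢
  rw [prob_triple_eq Q f hM, mul_assoc, mul_div_mul_left _ _ h2, div_div_eq_mul_div]

lemma inputOutputLaw_apply {U : Type*} {K : ℕ} {V : Fin K → Type*} (pU : PMF U)
    (W : U → PMF (∀ k, V k)) (u : U) (v : ∀ k, V k) :
    (inputOutputLaw pU W (u, v)).toReal = (pU u).toReal * (W u v).toReal := by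
  classical
  rw [inputOutputLaw, PMF.bind_apply, tsum_eq_single u, ENNReal.toReal_mul]
  · congr 1
    exact prob_of_injective (W u) (A := fun v => (u, v)) (Prod.mk_right_injective u) v
  · intro u' hu'
    rw [PMF.map_apply]
    simp [hu'.symm]

lemma prob_input {U : Type*} {K : ℕ} {V : Fin K → Type*} (pU : PMF U)
    (W : U → PMF (∀ k, V k)) (u : U) :
    prob (inputOutputLaw pU W) (fun ω => ω.1) u = (pU u).toReal := by
  rw [prob, inputOutputLaw, PMF.map_bind]
  simp_rw [PMF.map_comp]
  have : (fun u' => (W u').map ((fun ω : U × (∀ k, V k) => ω.1) ∘ fun v => (u', v))) = PMF.pure := by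
    funext u'
    exact PMF.map_const _ _
  rw [this, PMF.bind_pure]

/-- The sign is that of the log-ratio `p(u) / p(u|v)` of encoder weight to decoder weight for a
channel letter. -/
lemma mutualInfo_eq_neg_sum {U : Type*} {K : ℕ} {V : Fin K → Type*} [Fintype U]
    [∀ k, Fintype (V k)] (pU : PMF U) (W : U → PMF (∀ k, V k)) (k : Fin K) :
    mutualInfo (inputOutputLaw pU W) (fun ω => ω.1) (fun ω => ω.2 k) =
      -∑ u, ∑ v : ∀ k, V k, (pU u).toReal * (W u v).toReal * Real.log ((pU u).toReal /
        (prob (inputOutputLaw pU W) (fun ω => (ω.1, ω.2 k)) (u, v k) /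
          prob (inputOutputLaw pU W) (fun ω => ω.2 k) (v k))) := by
  rw [mutualInfo_eq_sum, Fintype.sum_prod_type, ← Finset.sum_neg_distrib]
  refine Finset.sum_congr rfl fun u _ => ?_
  rw [← Finset.sum_neg_distrib]
  refine Finset.sum_congr rfl fun v _ => ?_
  rw [inputOutputLaw_apply, prob_input, ← mul_neg, ← Real.log_inv, inv_div, div_div,
    mul_comm (prob (inputOutputLaw pU W) (fun ω => ω.2 k) (v k))]

end Letters

/-! ### Codes for the broadcast channel -/

lemma blockDistortion_le {A B : Type*} {n : ℕ} (hn : 0 < n) (d : A → B → ℝ≥0) (x : Fin n → A)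
    (y : Fin n → B) (M : ℝ) (h : ∑ j, (d (x j) (y j) : ℝ) ≤ n * M) : blockDistortion d x y ≤ M := by
  rw [blockDistortion, one_div_mul_eq_div, div_le_iff₀ (by exact_mod_cast hn), mul_comm]
  exact h

lemma sum_words_toReal_eq_one {A : Type*} [Fintype A] {n : ℕ} (p : Fin n → PMF A) :
    ∑ a : Fin n → A, ∏ j, (p j (a j)).toReal = 1 := by
  rw [← Fintype.prod_sum fun j a => (p j a).toReal]
  exact Finset.prod_eq_one fun j _ => sum_toReal_eq_one (p j)

/-- For words of every length `n` there is a code whose expected distortion at receiver `k` exceeds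
`D k + ε` by at most `β k n`, where `β k` tends to zero. -/
lemma exists_code_expectedDistortion_le {K : ℕ} {X U Z : Type*} {Y V Xhat : Fin K → Type*}
    [Fintype X] [Fintype U] [Fintype Z] [∀ k, Fintype (Y k)] [∀ k, Fintype (V k)]
    (W : U → PMF (∀ k, V k)) (d : ∀ k, X → Xhat k → ℝ≥0) (κ : ℝ) (D : Fin K → ℝ)
    (Q : PMF ((X × (∀ k, Y k)) × Z))
    (hM : IsMarkovChain Q (fun ω => ω.1.2) (fun ω => ω.1.1) (fun ω => ω.2))
    (pU : PMF U) (g : ∀ k, Z × Y k → Xhat k)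
    (hRate : ∀ k, condMutualInfo Q (fun ω => ω.1.1) (fun ω => ω.2) (fun ω => ω.1.2 k) <
      κ * mutualInfo (inputOutputLaw pU W) (fun ω => ω.1) (fun ω => ω.2 k))
    (hDist : ∀ k, expect Q (fun ω => (d k ω.1.1 (g k (ω.2, ω.1.2 k)) : ℝ)) ≤ D k)
    (ε : ℝ) (hε : 0 < ε) :
    ∃ β : Fin K → ℕ → ℝ, (∀ k, Filter.Tendsto (β k) Filter.atTop (nhds 0)) ∧
      ∀ m n : ℕ, 0 < n → (m : ℝ) = κ * n → ∃ c : Code m n X U Y V Xhat, ∀ k,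
        expectedDistortion (Q.map Prod.fst) W d c k ≤ D k + ε + β k n := by
  classical
  set src : X × (∀ k, Y k) → ℝ := fun s => (Q.map Prod.fst s).toReal
  let r : X × (∀ k, Y k) → Z → ℝ := fun s z => testChannel Q s.1 z
  let r' : ∀ k, Y k → Z → ℝ := fun k y z =>
    prob Q (fun ω => (ω.2, ω.1.2 k)) (z, y) / prob Q (fun ω => ω.1.2 k) y
  let t' : ∀ k, V k → U → ℝ := fun k v u => prob (inputOutputLaw pU W) (fun ω => (ω.1, ω.2 k)) (u, v) /
    prob (inputOutputLaw pU W) (fun ω => ω.2 k) v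
  -- The slack `ε` makes the mean of `δ k` strictly negative even if `D k` is attained.
  let δ : ∀ k, X × (∀ k, Y k) → Z → ℝ := fun k s z => (d k s.1 (g k (z, s.2 k)) : ℝ) - (D k + ε)
  have hsrc0 : ∀ s, 0 ≤ src s := fun s => ENNReal.toReal_nonneg
  have hr0 : ∀ s z, 0 ≤ r s z := fun s z => condWeight_nonneg Q (fun ω => ω.2) (fun ω => ω.1.1) z s.1
  have hq : ∀ s z, src s * r s z = (Q (s, z)).toReal := src_mul_testChannel Q hM
  have hb : ∀ u v, (pU u).toReal * (W u v).toReal = (inputOutputLaw pU W (u, v)).toReal :=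
    fun u v => (inputOutputLaw_apply pU W u v).symm
  have hq1 : ∑ s, ∑ z, src s * r s z = 1 := by
    simp_rw [hq]
    rw [← Fintype.sum_prod_type', sum_toReal_eq_one]
  have hb1 : ∑ u, ∑ v, (pU u).toReal * (W u v).toReal = 1 := by
    simp_rw [hb]
    rw [← Fintype.sum_prod_type', sum_toReal_eq_one]
  have hdecay := fun k => exists_tendsto_one_sub_matching_le src r (fun s => r' k (s.2 k))
    (fun u => (pU u).toReal) (fun u v => (W u v).toReal) (fun v => t' k (v k)) (δ k) hsrc0 hr0
    (fun _ => ENNReal.toReal_nonneg) (fun _ _ => ENNReal.toReal_nonneg) hq1 hb1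
    (fun s z h => condWeight_pos Q (fun ω => ω.2) (fun ω => ω.1.2 k) (s, z) (by rwa [← hq]))
    (fun u v h => condWeight_pos (inputOutputLaw pU W) (fun ω => ω.1) (fun ω => ω.2 k) (u, v)
      (by rwa [← hb])) κ
    (by
      simp only [δ, mul_sub, Finset.sum_sub_distrib, ← Finset.sum_mul, hq1]
      have := hDist k
      rw [expect, Fintype.sum_prod_type] at this
      simp only [← hq] at this
      linarith)
    (by
      have h := hRate k
      rw [condMutualInfo_eq_sum_testChannel Q (fun y => y k) hM, mutualInfo_eq_neg_sum, mul_neg,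
        lt_neg_iff_add_neg] at h
      exact h)
  choose β hβ0 hβ using hdecay
  let M : Fin K → ℝ := fun k => ∑ x, ∑ z, ∑ y, (d k x (g k (z, y)) : ℝ)
  have hdM : ∀ k x z y, (d k x (g k (z, y)) : ℝ) ≤ M k := by
    intro k x z y
    refine le_trans ?_ (Finset.single_le_sum (fun x _ => ?_) (Finset.mem_univ x))
    · refine le_trans ?_ (Finset.single_le_sum (fun z _ => ?_) (Finset.mem_univ z))
      · exact Finset.single_le_sum (f := fun y => (d k x (g k (z, y)) : ℝ))
          (fun y _ => NNReal.coe_nonneg _) (Finset.mem_univ y)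
      · positivity
    · positivity
  have hM0 : ∀ k, 0 ≤ M k := fun k => by positivity
  have hD0 : ∀ k, 0 ≤ D k := fun k =>
    (Finset.sum_nonneg fun ω _ => mul_nonneg ENNReal.toReal_nonneg (NNReal.coe_nonneg _)).trans
      (hDist k)
  refine ⟨fun k n => M k * ∑ k, β k n, fun k => ?_, fun m n hn hm => ?_⟩
  · simpa using (tendsto_finsetSum Finset.univ fun k _ => hβ0 k).const_mul (M k)
  have : Nonempty Z := ⟨Q.support_nonempty.some.2⟩
  have : Nonempty U := ⟨pU.support_nonempty.some⟩
  have hc0 : ∀ x z, 0 ≤ testChannel Q x z := fun x z =>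
    condWeight_nonneg Q (fun ω => ω.2) (fun ω => ω.1.1) z x
  have hc1 : ∀ x, ∑ z, testChannel Q x z ≤ 1 := fun x =>
    sum_condWeight_le_one Q (fun ω => ω.2) (fun ω => ω.1.1) x
  have hr'0 : ∀ k y z, 0 ≤ r' k y z := fun k y z =>
    condWeight_nonneg Q (fun ω => ω.2) (fun ω => ω.1.2 k) z y
  have hr'1 : ∀ k y, ∑ z, r' k y z ≤ 1 := fun k y =>
    sum_condWeight_le_one Q (fun ω => ω.2) (fun ω => ω.1.2 k) y
  have ht'0 : ∀ k v u, 0 ≤ t' k v u := fun k v u =>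
    condWeight_nonneg (inputOutputLaw pU W) (fun ω => ω.1) (fun ω => ω.2 k) u v
  have ht'1 : ∀ k v, ∑ u, t' k v u ≤ 1 := fun k v =>
    sum_condWeight_le_one (inputOutputLaw pU W) (fun ω => ω.1) (fun ω => ω.2 k) v
  have hp1 : ∑ u, (pU u).toReal ≤ 1 := (sum_toReal_eq_one pU).le
  have hS1 : ∑ s : Fin n → X × (∀ k, Y k), ∏ j, src (s j) = 1 :=
    sum_words_toReal_eq_one fun _ => Q.map Prod.fst
  clear_value r' t'
  obtain ⟨enc, dec, hcode⟩ := exists_one_shot_code (O := fun k => (Fin m → V k) × (Fin n → Y k))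
    (fun s : Fin n → X × (∀ k, Y k) => ∏ j, src (s j))
    (fun s => Finset.prod_nonneg fun j _ => hsrc0 _) hS1 (fun s j => (s j).1)
    (fun w : (Fin n → Z) × (Fin m → U) => w.2)
    (fun (a : Fin m → U) (v : Fin m → ∀ k, V k) => ∏ l, (W (a l) (v l)).toReal)
    (fun a v => Finset.prod_nonneg fun l _ => ENNReal.toReal_nonneg)
    (fun a => sum_words_toReal_eq_one fun l => W (a l))
    (fun x w => (∏ j, testChannel Q (x j) (w.1 j)) * ∏ l, (pU (w.2 l)).toReal)
    (fun x w => mul_nonneg (Finset.prod_nonneg fun j _ => hc0 _ _)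
      (Finset.prod_nonneg fun l _ => ENNReal.toReal_nonneg))
    (fun x => sum_words_le_one (fun j => testChannel Q (x j)) (fun _ u => (pU u).toReal)
      (fun j => hc0 _) (fun _ _ => ENNReal.toReal_nonneg) (fun j => hc1 _) fun _ => hp1)
    (fun k o w => (∏ j, r' k (o.2 j) (w.1 j)) * ∏ l, t' k (o.1 l) (w.2 l))
    (fun k o w => mul_nonneg (Finset.prod_nonneg fun j _ => hr'0 _ _ _)
      (Finset.prod_nonneg fun l _ => ht'0 _ _ _))
    (fun k o => sum_words_le_one (fun j => r' k (o.2 j)) (fun l => t' k (o.1 l))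
      (fun j => hr'0 _ _) (fun l => ht'0 _ _) (fun j => hr'1 _ _) fun l => ht'1 _ _)
    (fun k s v => (fun l => v l k, fun j => (s j).2 k))
    (fun k s w => ∑ j, δ k (s j) (w.1 j) ≤ 0)
  refine ⟨⟨fun x => (enc x).2, fun k o j => g k ((dec k o).1 j, o.2 j)⟩, fun k => ?_⟩
  have herr := (hcode k).trans (Finset.sum_le_sum fun k _ => hβ k n m hm)
  refine le_trans ?_ (add_le_add_right (mul_le_mul_of_nonneg_left herr (hM0 k)) _)
  have htot : ∑ s : Fin n → X × (∀ k, Y k), ∑ v : Fin m → (∀ k, V k),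
      (∏ j, src (s j)) * (∏ l, (W ((enc fun j => (s j).1).2 l) (v l)).toReal) = 1 := by
    simp_rw [← Finset.mul_sum, sum_words_toReal_eq_one, mul_one]
    exact hS1
  have hsplit : D k + ε = ∑ s : Fin n → X × (∀ k, Y k), ∑ v : Fin m → (∀ k, V k),
      (∏ j, src (s j)) * (∏ l, (W ((enc fun j => (s j).1).2 l) (v l)).toReal) * (D k + ε) := by
    simp_rw [← Finset.sum_mul, htot, one_mul]
  rw [hsplit, expectedDistortion]
  simp_rw [Finset.mul_sum, ← Finset.sum_add_distrib]
  refine Finset.sum_le_sum fun s _ => Finset.sum_le_sum fun v _ => ?_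
  have hw : 0 ≤ (∏ j, src (s j)) * ∏ l, (W ((enc fun j => (s j).1).2 l) (v l)).toReal :=
    mul_nonneg (Finset.prod_nonneg fun j _ => hsrc0 _)
      (Finset.prod_nonneg fun l _ => ENNReal.toReal_nonneg)
  rw [mul_left_comm (M k), ← mul_add]
  refine mul_le_mul_of_nonneg_left ?_ hw
  -- On success the decoder holds the encoder's word `z^n`, whose distortion is at most `D k + ε`;
  -- on failure the maximal distortion `M k` is charged, and `D k ≥ 0` covers the rest.
  split_ifs with h
  · rw [mul_zero, add_zero]
    refine blockDistortion_le hn _ _ _ _ ?_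
    have h2 := h.2
    simp only [δ, Finset.sum_sub_distrib, Finset.sum_const, Finset.card_univ, Fintype.card_fin,
      nsmul_eq_mul] at h2
    simp only [h.1]
    linarith
  · have : blockDistortion (d k) (fun j => (s j).1) (fun j =>
        g k ((dec k (fun l => v l k, fun j => (s j).2 k)).1 j, (s j).2 k)) ≤ M k := by
      refine blockDistortion_le hn _ _ _ _ ?_
      have := Finset.sum_le_card_nsmul Finset.univ (fun j => (d k (s j).1
        (g k ((dec k (fun l => v l k, fun j => (s j).2 k)).1 j, (s j).2 k)) : ℝ)) (M k)
        fun j _ => hdM k _ _ _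
      simpa using this
    have := hD0 k
    linarith

end WZBC

end

/-! ### Achievability -/

theorem mainTheorem6 {K : ℕ} {X U Z : Type*} {Y V Xhat : Fin K → Type*}
    [Fintype X] [Fintype U] [Fintype Z] [∀ k, Fintype (Y k)] [∀ k, Fintype (V k)]
    (src : PMF (X × (∀ k, Y k))) (W : U → PMF (∀ k, V k)) (d : ∀ k, X → Xhat k → ℝ≥0)
    (κ : ℚ) (D : Fin K → ℝ)
    -- the joint law of `((X, Y_1, …, Y_K), Z)`
    (Q : PMF ((X × (∀ k, Y k)) × Z)) (hQ : Q.map Prod.fst = src)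
    (hMarkov : WZBC.IsMarkovChain Q (fun ω => ω.1.2) (fun ω => ω.1.1) (fun ω => ω.2))
    -- the law of the channel input `U`
    (pU : PMF U)
    (g : ∀ k, Z × Y k → Xhat k)
    (hRate : ∀ k, WZBC.condMutualInfo Q (fun ω => ω.1.1) (fun ω => ω.2) (fun ω => ω.1.2 k) <
      (κ : ℝ) * WZBC.mutualInfo (WZBC.inputOutputLaw pU W) (fun ω => ω.1) (fun ω => ω.2 k))
    (hDist : ∀ k, WZBC.expect Q (fun ω => (d k ω.1.1 (g k (ω.2, ω.1.2 k)) : ℝ)) ≤ D k) :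
    WZBC.Achievable src W d κ D := by
  subst hQ
  intro ε hε
  -- Half of `ε` is slack in the distortion threshold, half absorbs the failure term. The latter
  -- depends on `n` only, so `n₀` is uniform in `m`.
  obtain ⟨β, hβ0, hβ⟩ := WZBC.exists_code_expectedDistortion_le W d κ D Q hMarkov pU g hRate hDist
    (ε / 2) (half_pos hε)
  have hev : ∀ᶠ n in Filter.atTop, ∀ k, β k n < ε / 2 :=
    Filter.eventually_all.2 fun k => (hβ0 k).eventually_lt_const (half_pos hε)
  obtain ⟨n₀, hn₀⟩ := Filter.eventually_atTop.1 hev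
  refine ⟨n₀, fun m n _ hn hκ => ?_⟩
  have hn0 : 0 < n := (Nat.zero_le _).trans_lt hn
  have hm : (m : ℝ) = κ * n := by
    rw [div_eq_iff (by positivity)] at hκ
    exact_mod_cast hκ
  obtain ⟨c, hc⟩ := hβ m n hn0 hm
  refine ⟨c, fun k => (hc k).trans ?_⟩
  have := hn₀ n hn.le k
  linarith
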